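/- Let $n \ge 1$ and let $G$ be a simple graph with vertex set $V=\{1,\dots,n\}$. Let $\widetilde G$ be the extended graph of $G$, obtained from $G$ by adding a new vertex $0$ and joining it to every vertex in $V$. Put $x_0 = x$, and let $x, x_1, \dots, x_n$ be independent commuting variables. Define the polynomial with integer coefficients $$f_G(x;x_1,\dots,x_n) \;=\; \sum_{T} \ \prod_{v\in\{0,1,\dots,n\}} x_v^{\deg_T(v)-1},$$ where $T$ runs over all spanning trees of $\widetilde G$ and $\deg_T(v)$ is the degree of $v$ in $T$. Let $\overline G$ be the complement of $G$, that is, the simple graph on $V$ in which two distinct vertices are adjacent if and only if they are not adjacent in $G$. Then $$f_G(x;x_1,\dots,x_n) \;=\; (-1)^{n-1}\, f_{\overline G}(-x-x_1-\cdots-x_n;\;x_1,\dots,x_n).$$ -/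

import Mathlib

namespace TreeReciprocity

/-- The extended graph of a graph `G` on `V`: a new vertex, the root (`none`, which plays the
role of `0`), is added and joined to every vertex of `G`. -/
def extendedGraph {V : Type*} (G : SimpleGraph V) : SimpleGraph (Option V) where
  Adj
    | none, none => False
    | none, some _ => True
    | some _, none => True
    | some u, some v => G.Adj u v
  symm := ⟨by
    rintro (_ | u) (_ | v) h
    · exact h
    · exact h
    · exact h
    · exact G.symm.symm _ _ h⟩
  loopless := ⟨by
    rintro (_ | u) h
    · exact h
    · exact G.irrefl h⟩

open Classical in
/-- The spanning trees of a finite graph `G`: the graphs on the full vertex set whose edges are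
edges of `G` and which are trees. -/
noncomputable def spanningTrees {V : Type*} [Fintype V] (G : SimpleGraph V) :
    Finset (SimpleGraph V) :=
  {T : SimpleGraph V | T ≤ G ∧ T.IsTree}

open Classical in
/-- The monomial `∏ v, x_v ^ (deg_T v - 1)`. If `T` is a tree with at least two vertices, every
degree is at least one, so that the subtraction in the exponent is the usual one. -/
noncomputable def treeMonomial {V : Type*} [Fintype V] (T : SimpleGraph V) : MvPolynomial V ℤ :=
  ∏ v : V, MvPolynomial.X v ^ (T.degree v - 1)

/-- The polynomial `t_G`, the sum of the monomials of the spanning trees of `G`. -/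
noncomputable def treePolynomial {V : Type*} [Fintype V] (G : SimpleGraph V) : MvPolynomial V ℤ :=
  ∑ T ∈ spanningTrees G, treeMonomial T

/-- The polynomial `f_G`, that is `t` of the extended graph of `G`. The variable `x` of the root
is `MvPolynomial.X none` and the variable `x_v` is `MvPolynomial.X (some v)`. -/
noncomputable def forestPolynomial {V : Type*} [Fintype V] (G : SimpleGraph V) :
    MvPolynomial (Option V) ℤ :=
  treePolynomial (extendedGraph G)

/-- The polynomial `f_G(p; q)` obtained from `f_G` by substituting the polynomial `p` for the variable
of the root and the polynomial `q v` for the variable of the vertex `v`. -/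
noncomputable def forestPolynomialAt {V : Type*} [Fintype V] (G : SimpleGraph V)
    {σ : Type*} (p : MvPolynomial σ ℤ) (q : V → MvPolynomial σ ℤ) : MvPolynomial σ ℤ :=
  MvPolynomial.bind₁ (fun o : Option V => o.elim p q) (forestPolynomial G)

end TreeReciprocity

/-!
The identity is read off from a matrix-tree theorem.  For weights `w` on `Option V`, let `M_G(w)` be
the matrix with diagonal entries `∑ w a`, over the neighbours `a` of `v` in the extended graph, and
off-diagonal entries `-w u` for `u` adjacent to `v` in `G` (`rootedLaplacian`).  Then
`w none * f_G(w) = det M_G(w)` (`mul_forestPolynomialAt`).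

To see this, orient every spanning tree of the extended graph towards the root `none`.  A tree becomes
a map `p : V → Option V` sending each vertex to its parent, all of whose orbits end at the root, and
since `deg v - 1` counts the children of `v`, the monomial of the tree times the root variable
is `∏ v, x_{p v}`.  On the other side, row `v` of `M_G(w)` is the sum of `w a • (e_v - e_a)` over the
neighbours `a` of `v`, where `e_none = 0`.  Multilinearity of the determinant gives a sum over all
maps `p` with `p v` adjacent to `v` of `∏ v, w (p v)` times the determinant of the matrix with
rows `e_v - e_{p v}`.  That determinant is `1` if all orbits of `p` reach the root, and `0` otherwise.

For the reciprocity, let `s` be the sum of the variables of the vertices of `G`.  Replacing `G` by its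
complement and `x` by `-x - s` turns `M_G` into `-(M_G + 1 wᵀ)`, where `1` is the all-ones column.
Since `M_G 1 = x 1`, this rank-one update multiplies the determinant by `(x + s) / x`, and
cancelling `x` and `x + s` leaves the claim.
-/

namespace TreeReciprocity

open Finset Matrix

/-! ### Parent maps -/

/-- A map `p`, read as assigning to each vertex its parent, is rooted if every orbit of `p`
ends at the root `none`. -/
def IsRooted {V : Type*} (p : V → Option V) : Prop :=
  ∀ v, ∃ k, (fun o : Option V => o.bind p)^[k] (some v) = none

theorem isRooted_iff_exists_depth {V : Type*} {p : V → Option V} :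
    IsRooted p ↔ ∃ d : Option V → ℕ, ∀ v, d (p v) < d (some v) := by
  classical
  constructor
  · intro h
    have h' : ∀ o : Option V, ∃ k, (fun o : Option V => o.bind p)^[k] o = none := by
      rintro (_ | v)
      · exact ⟨0, rfl⟩
      · exact h v
    refine ⟨fun o => Nat.find (h' o), fun v => ?_⟩
    have hs := Nat.find_spec (h' (some v))
    obtain ⟨m, hm⟩ : ∃ m, Nat.find (h' (some v)) = m + 1 := by
      refine Nat.exists_eq_succ_of_ne_zero fun h0 => ?_
      rw [h0] at hs
      simp at hs
    rw [hm, Function.iterate_succ_apply] at hs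
    have := Nat.find_min' (h' (p v)) hs
    show Nat.find (h' (p v)) < Nat.find (h' (some v))
    omega
  · rintro ⟨d, hd⟩ v
    induction hn : d (some v) using Nat.strong_induction_on generalizing v with
    | _ n ih =>
      cases hp : p v with
      | none => exact ⟨1, by simp [hp]⟩
      | some u =>
        have hlt := hd v
        rw [hp, hn] at hlt
        obtain ⟨k, hk⟩ := ih _ hlt u rfl
        exact ⟨k + 1, by rw [Function.iterate_succ_apply]; simpa [hp] using hk⟩

/-- The graph on `Option V` whose edges join each vertex to its parent. -/
def parentGraph {V : Type*} (p : V → Option V) : SimpleGraph (Option V) :=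
  SimpleGraph.fromEdgeSet (Set.range fun v => s(some v, p v))

section ParentGraph

variable {V : Type*} {p : V → Option V}

theorem IsRooted.ne_some (hp : IsRooted p) (v : V) : p v ≠ some v := by
  obtain ⟨d, hd⟩ := isRooted_iff_exists_depth.1 hp
  intro h
  have := hd v
  rw [h] at this
  exact lt_irrefl _ this

theorem IsRooted.not_two_cycle (hp : IsRooted p) {u v : V} (hu : p u = some v) :
    p v ≠ some u := by
  obtain ⟨d, hd⟩ := isRooted_iff_exists_depth.1 hp
  intro hv
  have h1 := hd u
  have h2 := hd v
  rw [hu] at h1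
  rw [hv] at h2
  exact lt_asymm h1 h2

theorem IsRooted.adj (hp : IsRooted p) (v : V) : (parentGraph p).Adj (some v) (p v) :=
  (SimpleGraph.fromEdgeSet_adj _).2 ⟨⟨v, rfl⟩, (hp.ne_some v).symm⟩

theorem IsRooted.adj_some_some_iff (hp : IsRooted p) {u v : V} :
    (parentGraph p).Adj (some u) (some v) ↔ p u = some v ∨ p v = some u := by
  constructor
  · intro h
    obtain ⟨⟨w, hw⟩, -⟩ := (SimpleGraph.fromEdgeSet_adj _).1 h
    rcases Sym2.eq_iff.1 hw with ⟨h1, h2⟩ | ⟨h1, h2⟩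
    · cases h1; exact Or.inl h2
    · cases h1; exact Or.inr h2
  · rintro (h | h)
    · exact h ▸ hp.adj u
    · exact (h ▸ hp.adj v).symm

theorem IsRooted.adj_none_some_iff (hp : IsRooted p) {v : V} :
    (parentGraph p).Adj none (some v) ↔ p v = none := by
  constructor
  · intro h
    obtain ⟨⟨w, hw⟩, -⟩ := (SimpleGraph.fromEdgeSet_adj _).1 h
    rcases Sym2.eq_iff.1 hw with ⟨h1, h2⟩ | ⟨h1, h2⟩
    · cases h1
    · cases h1; exact h2
  · intro h
    exact (h ▸ hp.adj v).symm

theorem IsRooted.connected (hp : IsRooted p) : (parentGraph p).Connected := by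
  obtain ⟨d, hd⟩ := isRooted_iff_exists_depth.1 hp
  have key : ∀ n, ∀ o : Option V, d o = n → (parentGraph p).Reachable o none := by
    intro n
    induction n using Nat.strong_induction_on with
    | _ n ih =>
      rintro (_ | v) hn
      · exact SimpleGraph.Reachable.refl _
      · exact (hp.adj v).reachable.trans (ih _ (hn ▸ hd v) _ rfl)
  exact SimpleGraph.connected_iff _ |>.2
    ⟨fun a b => (key _ a rfl).trans (key _ b rfl).symm, ⟨none⟩⟩

theorem IsRooted.isTree [Fintype V] (hp : IsRooted p) : (parentGraph p).IsTree := by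
  refine SimpleGraph.isTree_iff_connected_and_card.2 ⟨hp.connected, le_antisymm ?_
    hp.connected.card_vert_le_card_edgeSet_add_one⟩
  rw [Nat.card_eq_fintype_card (α := Option V), Fintype.card_option, ← Nat.card_eq_fintype_card]
  refine Nat.add_le_add_right ?_ 1
  refine (Nat.card_mono (Set.finite_range fun v => s(some v, p v)) ?_).trans
    (Finite.card_range_le _)
  rw [parentGraph, SimpleGraph.edgeSet_fromEdgeSet]
  exact Set.sdiff_subset

/-- A rooted parent map is determined by its graph: at a vertex of minimal depth where two such
maps differ, the second one would have a cycle of length two. -/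
theorem IsRooted.eq_of_parentGraph_eq {q : V → Option V} (hp : IsRooted p) (hq : IsRooted q)
    (h : parentGraph p = parentGraph q) : p = q := by
  obtain ⟨d, hd⟩ := isRooted_iff_exists_depth.1 hp
  funext v
  induction hn : d (some v) using Nat.strong_induction_on generalizing v with
  | _ n ih =>
    have hv := h ▸ hp.adj v
    cases hpv : p v with
    | none =>
      rw [hpv] at hv
      exact (hq.adj_none_some_iff.1 hv.symm).symm
    | some u =>
      rw [hpv] at hv
      rcases hq.adj_some_some_iff.1 hv with h1 | h1
      · exact h1.symm
      · have hlt := hd v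
        rw [hpv, hn] at hlt
        rw [← ih _ hlt u rfl] at h1
        exact absurd h1 (hp.not_two_cycle hpv)

/-- Every tree on `Option V` is the graph of a rooted parent map: a vertex is sent to a neighbour
closer to the root.  The graph of this map is connected and contained in the tree, so it is the
whole tree. -/
theorem exists_parentGraph_eq {T : SimpleGraph (Option V)} (hT : T.IsTree) :
    ∃ p : V → Option V, IsRooted p ∧ parentGraph p = T := by
  have hex : ∀ v : V, ∃ a, T.Adj (some v) a ∧ T.dist a none < T.dist (some v) none := by
    intro v
    obtain ⟨W, hW⟩ := hT.connected.exists_walk_length_eq_dist (some v) none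
    cases W with
    | cons hadj W =>
      refine ⟨_, hadj, ?_⟩
      have := SimpleGraph.dist_le W
      rw [SimpleGraph.Walk.length_cons] at hW
      omega
  choose p hadj hdist using hex
  have hp : IsRooted p := isRooted_iff_exists_depth.2 ⟨fun o => T.dist o none, hdist⟩
  have hle : parentGraph p ≤ T := by
    intro a b hab
    obtain ⟨⟨w, hw⟩, -⟩ := (SimpleGraph.fromEdgeSet_adj _).1 hab
    rw [← SimpleGraph.mem_edgeSet, ← hw]
    exact hadj w
  exact ⟨p, hp, le_antisymm hle
    ((SimpleGraph.isTree_iff_minimal_connected.1 hT).2 hp.connected hle)⟩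

open Classical in
theorem IsRooted.degree_none [Fintype V] (hp : IsRooted p) :
    (parentGraph p).degree none = #{v | p v = none} := by
  rw [← SimpleGraph.card_neighborFinset_eq_degree,
    ← card_map (⟨some, Option.some_injective V⟩ : V ↪ Option V)]
  congr 1
  ext (_ | v)
  · simp
  · simp [hp.adj_none_some_iff]

open Classical in
theorem IsRooted.degree_some [Fintype V] (hp : IsRooted p) (u : V) :
    (parentGraph p).degree (some u) = #{v | p v = some u} + 1 := by
  rw [← SimpleGraph.card_neighborFinset_eq_degree,
    ← card_map (⟨some, Option.some_injective V⟩ : V ↪ Option V), ← card_insert_of_notMem (a := p u)]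
  · congr 1
    ext (_ | v)
    · simp [SimpleGraph.adj_comm _ (some u) none, hp.adj_none_some_iff, eq_comm]
    · simp [hp.adj_some_some_iff, eq_comm]
  · simp only [mem_map, mem_filter, mem_univ, true_and, Function.Embedding.coeFn_mk, not_exists,
      not_and]
    exact fun v hv hvu => hp.not_two_cycle hv hvu.symm

open Classical in
/-- In the tree of a rooted parent map, `deg v - 1` is the number of children of `v` if `v` is not
the root, and one less than that for the root. -/
theorem IsRooted.X_none_mul_treeMonomial [Fintype V] [Nonempty V] (hp : IsRooted p) :
    MvPolynomial.X none * treeMonomial (parentGraph p) = ∏ v, MvPolynomial.X (p v) := by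
  have hpos : 0 < (parentGraph p).degree none :=
    hp.connected.preconnected.degree_pos_of_nontrivial none
  have hchildren : ∏ v, (MvPolynomial.X (p v) : MvPolynomial (Option V) ℤ) =
      ∏ a, MvPolynomial.X a ^ #{v | p v = a} := by
    simp_rw [← prod_const]
    exact (prod_fiberwise' univ p _).symm
  have hsome : ∀ u, (parentGraph p).degree (some u) - 1 = #{v | p v = some u} := fun u => by
    rw [hp.degree_some u, Nat.add_sub_cancel]
  rw [hchildren, treeMonomial, Fintype.prod_option, Fintype.prod_option, ← mul_assoc, ← pow_succ',
    Nat.sub_add_cancel hpos, hp.degree_none]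
  simp_rw [hsome]

end ParentGraph

open Classical in
/-- The sum over spanning trees becomes a sum over rooted parent maps along edges of `G`. -/
theorem X_none_mul_forestPolynomial {V : Type*} [Fintype V] [Nonempty V] (G : SimpleGraph V) :
    MvPolynomial.X none * forestPolynomial G =
      ∑ p : V → Option V with (∀ v, (extendedGraph G).Adj (some v) (p v)) ∧ IsRooted p,
        ∏ v, MvPolynomial.X (p v) := by
  rw [forestPolynomial, treePolynomial, mul_sum]
  refine (sum_nbij parentGraph ?_ ?_ ?_ ?_).symm
  · intro p hp
    simp only [mem_filter, mem_univ, true_and] at hp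
    simp only [spanningTrees, mem_filter, mem_univ, true_and]
    refine ⟨fun a b hab => ?_, hp.2.isTree⟩
    obtain ⟨⟨w, hw⟩, -⟩ := (SimpleGraph.fromEdgeSet_adj _).1 hab
    rw [← SimpleGraph.mem_edgeSet, ← hw]
    exact hp.1 w
  · intro p hp q hq h
    simp only [coe_filter, mem_univ, true_and, Set.mem_ofPred_eq] at hp hq
    exact hp.2.eq_of_parentGraph_eq hq.2 h
  · intro T hT
    simp only [spanningTrees, coe_filter, mem_univ, true_and, Set.mem_ofPred_eq] at hT
    obtain ⟨p, hp, rfl⟩ := exists_parentGraph_eq hT.2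
    refine ⟨p, ?_, rfl⟩
    simp only [coe_filter, mem_univ, true_and, Set.mem_ofPred_eq]
    exact ⟨fun v => hT.1 (hp.adj v), hp⟩
  · intro p hp
    simp only [mem_filter, mem_univ, true_and] at hp
    exact hp.2.X_none_mul_treeMonomial.symm

/-! ### The determinant of a parent map -/

open Classical in
/-- The matrix whose row at `v` is `e_v - e_{p v}`, where `e_none` is zero. -/
noncomputable def parentMatrix {V : Type*} (R : Type*) [CommRing R] (p : V → Option V) :
    Matrix V V R :=
  of fun v u => (if v = u then 1 else 0) - (if p v = some u then 1 else 0)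

open Classical in
theorem det_parentMatrix_of_isRooted {V R : Type*} [Fintype V] [CommRing R] {p : V → Option V}
    (hp : IsRooted p) : (parentMatrix R p).det = 1 := by
  obtain ⟨d, hd⟩ := isRooted_iff_exists_depth.1 hp
  -- Ordering the vertices by decreasing depth makes the matrix unitriangular.
  have htri : (parentMatrix R p).BlockTriangular fun v => OrderDual.toDual (d (some v)) := by
    intro v u huv
    have huv : d (some v) < d (some u) := huv
    have h1 : v ≠ u := by rintro rfl; exact lt_irrefl _ huv
    have h2 : p v ≠ some u := fun h => lt_asymm huv (h ▸ hd v)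
    simp [parentMatrix, h1, h2]
  rw [htri.det]
  refine prod_eq_one fun a _ => ?_
  suffices h : (parentMatrix R p).toSquareBlock (fun v => OrderDual.toDual (d (some v))) a = 1 by
    rw [h, det_one]
  ext ⟨v, hv⟩ ⟨u, hu⟩
  have h2 : p v ≠ some u := by
    intro h
    have h3 := hd v
    rw [h] at h3
    exact h3.ne (OrderDual.toDual.injective (hu.trans hv.symm))
  simp [parentMatrix, toSquareBlock_def, h2, one_apply]

open Classical in
theorem det_parentMatrix_of_not_isRooted {V R : Type*} [Fintype V] [CommRing R] [IsDomain R]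
    {p : V → Option V} (hp : ¬ IsRooted p) : (parentMatrix R p).det = 0 := by
  rw [IsRooted, not_forall] at hp
  obtain ⟨v₀, hv₀⟩ := hp
  -- The indicator vector of the vertices whose orbit avoids the root lies in the kernel.
  set S : Option V → Prop := fun o => ¬ ∃ k, (fun o : Option V => o.bind p)^[k] o = none with hS
  have hnone : ¬ S none := fun h => h ⟨0, rfl⟩
  have hstep : ∀ v, S (p v) ↔ S (some v) := by
    intro v
    refine not_congr ⟨?_, ?_⟩
    · rintro ⟨k, hk⟩
      exact ⟨k + 1, by rw [Function.iterate_succ_apply]; exact hk⟩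
    · rintro ⟨_ | k, hk⟩
      · simp at hk
      · rw [Function.iterate_succ_apply] at hk
        exact ⟨k, hk⟩
  refine exists_mulVec_eq_zero_iff.1 ⟨fun v => if S (some v) then 1 else 0, ?_, ?_⟩
  · intro h
    have := congrFun h v₀
    simp only [Pi.zero_apply, ite_eq_right_iff, one_ne_zero, imp_false] at this
    exact this hv₀
  · ext v
    simp only [mulVec, dotProduct, parentMatrix, of_apply, sub_mul, ite_mul, one_mul, zero_mul,
      sum_sub_distrib, sum_ite_eq, mem_univ, if_true, Pi.zero_apply, ← hstep v]
    cases hpv : p v with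
    | none => simp [hnone]
    | some u => simp

/-! ### The matrix-tree theorem for extended graphs -/

open Classical in
/-- The weighted Laplacian of the extended graph with the row and column of the root deleted.  The
edge from `v` towards its neighbour `a` has weight `w a`. -/
noncomputable def rootedLaplacian {V R : Type*} [Fintype V] [CommRing R] (G : SimpleGraph V)
    (w : Option V → R) : Matrix V V R :=
  of fun v u => (if v = u then w none + ∑ a with G.Adj v a, w (some a) else 0) -
    (if G.Adj v u then w (some u) else 0)

open Classical in
theorem det_rootedLaplacian {V R : Type*} [Fintype V] [CommRing R] [IsDomain R]
    (G : SimpleGraph V) (w : Option V → R) :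
    (rootedLaplacian G w).det =
      ∑ p : V → Option V with (∀ v, (extendedGraph G).Adj (some v) (p v)) ∧ IsRooted p,
        ∏ v, w (p v) := by
  -- The row at `v` is `∑ w a • (e_v - e_a)` over the neighbours `a` of `v` in the extended graph.
  have hrow : rootedLaplacian G w = fun v => ∑ a : Option V,
      (if (extendedGraph G).Adj (some v) a then w a else 0) •
        (fun u => (if v = u then 1 else 0) - (if a = some u then 1 else 0) : V → R) := by
    ext v u
    have hn : (extendedGraph G).Adj (some v) none := trivial
    have hs : ∀ a, (extendedGraph G).Adj (some v) (some a) ↔ G.Adj v a := fun _ => Iff.rfl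
    simp only [rootedLaplacian, of_apply, Finset.sum_apply, Pi.smul_apply, smul_eq_mul,
      Fintype.sum_option, hn, hs, if_true, mul_sub, sum_sub_distrib, mul_ite, mul_one, mul_zero,
      sum_ite_eq', mem_univ]
    split_ifs with h <;> simp [sum_filter]
  have hdet : (rootedLaplacian G w).det = ∑ p : V → Option V,
      (∏ v, if (extendedGraph G).Adj (some v) (p v) then w (p v) else 0) *
        (parentMatrix R p).det := by
    rw [hrow]
    change (detRowAlternating (R := R) (n := V)).toMultilinearMap _ = _
    rw [MultilinearMap.map_sum]
    refine sum_congr rfl fun p _ => ?_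
    rw [MultilinearMap.map_smul_univ]
    rfl
  rw [hdet, sum_filter]
  refine sum_congr rfl fun p _ => ?_
  by_cases hp : IsRooted p
  · by_cases hG : ∀ v, (extendedGraph G).Adj (some v) (p v)
    · simp [det_parentMatrix_of_isRooted hp, hp, hG]
    · obtain ⟨v, hv⟩ := not_forall.1 hG
      rw [if_neg fun h => hG h.1, prod_eq_zero (mem_univ v) (if_neg hv), zero_mul]
  · rw [if_neg fun h => hp h.2, det_parentMatrix_of_not_isRooted hp, mul_zero]

open Classical in
/-- The weighted matrix-tree theorem for the extended graph, after substitution. -/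
theorem mul_forestPolynomialAt {V σ : Type*} [Fintype V] [Nonempty V] (G : SimpleGraph V)
    (x : MvPolynomial σ ℤ) (q : V → MvPolynomial σ ℤ) :
    x * forestPolynomialAt G x q = (rootedLaplacian G fun o => o.elim x q).det := by
  have h := congrArg (MvPolynomial.bind₁ fun o : Option V => o.elim x q)
    (X_none_mul_forestPolynomial G)
  simp only [map_mul, map_sum, map_prod, MvPolynomial.bind₁_X_right, Option.elim_none] at h
  rw [det_rootedLaplacian]
  exact h

/-! ### Complementation -/

section Reciprocity

variable {V R : Type*} [Fintype V] [CommRing R]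

open Classical in
theorem rootedLaplacian_mulVec_one (G : SimpleGraph V) (w : Option V → R) :
    rootedLaplacian G w *ᵥ 1 = w none • 1 := by
  ext v
  simp [rootedLaplacian, mulVec, dotProduct, sum_filter]

open Classical in
/-- The substitution `x ↦ -x - ∑ v, q v` is the one that makes the diagonals agree. -/
theorem rootedLaplacian_compl (G : SimpleGraph V) (x : R) (q : V → R) :
    rootedLaplacian Gᶜ (fun o => o.elim (-x - ∑ v, q v) q) =
      -(rootedLaplacian G (fun o => o.elim x q) + vecMulVec 1 q) := by
  ext v u
  -- The complement is named `H` so that its adjacency is decided classically, as in the definition.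
  have hsum : ∀ H, H = Gᶜ → ∑ a with H.Adj v a, q a + ∑ a with G.Adj v a, q a =
      ∑ a, q a - q v := by
    rintro H rfl
    rw [eq_sub_iff_add_eq, sum_filter, sum_filter, ← sum_add_distrib,
      ← Fintype.sum_ite_eq v q, ← sum_add_distrib]
    refine sum_congr rfl fun a _ => ?_
    by_cases h : v = a
    · subst h; simp
    · by_cases h' : G.Adj v a <;> simp [h, h']
  by_cases h : v = u
  · subst h
    simp only [rootedLaplacian, of_apply, if_true, SimpleGraph.irrefl, if_false, Option.elim_none,
      Option.elim_some, Matrix.neg_apply, Matrix.add_apply, vecMulVec_apply, Pi.one_apply, one_mul]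
    linear_combination hsum _ rfl
  · by_cases h' : G.Adj v u <;>
      simp [rootedLaplacian, h, h']

open Classical in
/-- The matrix determinant lemma for a column which is an eigenvector, multiplied by the eigenvalue so
that no inverse is needed. -/
theorem mul_det_add_vecMulVec [Nonempty V] {M : Matrix V V R} {u : V → R} {x : R}
    (h : M *ᵥ u = x • u) (hx : IsRegular x) (q : V → R) :
    x * (M + vecMulVec u q).det = (x + q ⬝ᵥ u) * M.det := by
  obtain ⟨m, hm⟩ : ∃ m, Fintype.card V = m + 1 :=
    Nat.exists_eq_succ_of_ne_zero Fintype.card_ne_zero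
  -- The second factor has determinant `x ^ m * (x + q ⬝ᵥ u)`, a characteristic polynomial at `x`.
  have hfac : M * (scalar V x - vecMulVec u (-q)) = x • (M + vecMulVec u q) := by
    rw [mul_sub, mul_vecMulVec, h, vecMulVec_neg, sub_neg_eq_add, smul_add, smul_vecMulVec,
      scalar_apply, ← smul_one_eq_diagonal, mul_smul_comm, mul_one]
  have hdet := congrArg det hfac
  rw [det_mul, det_smul, ← eval_charpoly, charpoly_vecMulVec, hm] at hdet
  simp only [Polynomial.eval_sub, Polynomial.eval_pow, Polynomial.eval_X, Polynomial.eval_smul,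
    dotProduct_neg, smul_eq_mul, Nat.add_sub_cancel] at hdet
  refine (hx.pow m).left ?_
  change x ^ m * _ = x ^ m * _
  rw [dotProduct_comm q u]
  linear_combination -hdet

end Reciprocity

open Classical in
theorem forestPolynomial_eq_compl {V : Type*} [Fintype V] [Nonempty V] (G : SimpleGraph V) :
    forestPolynomial G = (-1) ^ (Fintype.card V - 1) * forestPolynomialAt Gᶜ
      (-MvPolynomial.X none - ∑ v, MvPolynomial.X (some v)) fun v => MvPolynomial.X (some v) := by
  set x : MvPolynomial (Option V) ℤ := MvPolynomial.X none with hx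
  set q : V → MvPolynomial (Option V) ℤ := fun v => MvPolynomial.X (some v) with hq
  set s : MvPolynomial (Option V) ℤ := ∑ v, MvPolynomial.X (some v) with hs
  obtain ⟨m, hm⟩ : ∃ m, Fintype.card V = m + 1 :=
    Nat.exists_eq_succ_of_ne_zero Fintype.card_ne_zero
  have hx0 : x ≠ 0 := MvPolynomial.X_ne_zero _
  have hxs0 : x + s ≠ 0 := by
    intro h
    have := congrArg (MvPolynomial.eval fun o : Option V => o.elim (1 : ℤ) fun _ => 0) h
    simp [hx, hs] at this
  have hself : forestPolynomialAt G x q = forestPolynomial G := by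
    have hX : (fun o : Option V => o.elim x q) = MvPolynomial.X := by
      funext o
      cases o <;> rfl
    rw [forestPolynomialAt, hX, MvPolynomial.bind₁_X_left, AlgHom.id_apply]
  have hG := mul_forestPolynomialAt G x q
  set D := (rootedLaplacian G (fun o => o.elim x q) + vecMulVec 1 q).det with hD
  have hGc : (-x - s) * forestPolynomialAt Gᶜ (-x - s) q = (-1) ^ (m + 1) * D := by
    rw [mul_forestPolynomialAt, hs, rootedLaplacian_compl G x q, det_neg, hm]
  have hupd := mul_det_add_vecMulVec (rootedLaplacian_mulVec_one G fun o => o.elim x q)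
    (IsRegular.of_ne_zero hx0) q
  rw [hself] at hG
  rw [← hD, ← hG, dotProduct_one] at hupd
  rw [hm, Nat.add_sub_cancel]
  have hsign : ((-1 : MvPolynomial (Option V) ℤ) ^ m) * (-1) ^ m = 1 := by
    rw [← mul_pow, neg_one_mul, neg_neg, one_pow]
  refine mul_left_cancel₀ (mul_ne_zero hx0 hxs0) ?_
  simp only [Option.elim_none] at hupd
  change x * _ = (x + s) * (x * _) at hupd
  linear_combination -hupd + (-1) ^ m * x * hGc - x * D * hsign

end TreeReciprocity

theorem mainTheorem2 (n : ℕ) (hn : 1 ≤ n) (G : SimpleGraph (Fin n)) :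
    TreeReciprocity.forestPolynomial G =
      (-1 : MvPolynomial (Option (Fin n)) ℤ) ^ (n - 1) *
        TreeReciprocity.forestPolynomialAt Gᶜ
          (-MvPolynomial.X none - ∑ i : Fin n, MvPolynomial.X (some i))
          (fun i : Fin n => MvPolynomial.X (some i)) := by
  have : Nonempty (Fin n) := ⟨⟨0, hn⟩⟩
  simpa using TreeReciprocity.forestPolynomial_eq_compl G
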